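/- A mixed graph is a finite simple graph $G$ that may contain both undirected edges and directed arcs: there are no loops, and any two distinct vertices are joined by at most one edge or arc (in particular not by two opposite arcs). A cycle of $G$ of length $n\ge 3$ is a closed walk $(v_0,v_1,\dots,v_n=v_0)$ with $v_0,\dots,v_{n-1}$ distinct such that for each $0\le i<n$ either $v_iv_{i+1}$ is an edge or $(v_i,v_{i+1})$ is an arc of $G$ (so edges may be traversed in either direction, arcs only forwards). The girth of $G$ is the length of a shortest cycle. A $[z,r;g]$-mixed graph is a mixed graph of girth $g$ in which every vertex is the tail of exactly $z$ arcs, the head of exactly $z$ arcs, and is incident with exactly $r$ edges. A $[z,r;g]$-mixed cage is a $[z,r;g]$-mixed graph of minimum order, and $n[z,r;g]$ denotes its order. **Theorem.** Let $z\in\{1,2\}$, $r\ge 1$ and $3\le g_1<g_2$ be integers. Then $[z,r;g_1]$-mixed cages and $[z,r;g_2]$-mixed cages exist, and $$n[z,r;g_1]<n[z,r;g_2].$$ -/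

import Mathlib

/-- A simple mixed graph on the vertex set `V`: it has undirected edges (`edge`) and directed arcs
(`arc u v` is the arc from `u` to `v`), without loops, and any two vertices are joined by at most
one edge or arc. -/
structure MixedGraph (V : Type*) where
  edge : SimpleGraph V
  arc : V → V → Prop
  arc_asymm : ∀ u v, arc u v → ¬ arc v u
  arc_not_edge : ∀ u v, arc u v → ¬ edge.Adj u v

namespace MixedGraph

/-- One step of a walk: an edge (in either direction) or an arc traversed forwards. -/
def Step {V : Type*} (G : MixedGraph V) (u v : V) : Prop :=
  G.edge.Adj u v ∨ G.arc u v

/-- `(c 0, c 1, …, c n)` is a cycle of length `n` of `G`: a closed walk along edges and arcs whose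
vertices `c 0, …, c (n - 1)` are distinct. As `G` is simple, a cycle has length at least three
(going back and forth along one edge is not a cycle). Only the values `c 0, …, c n` matter. -/
def IsCycle {V : Type*} (G : MixedGraph V) (n : ℕ) (c : ℕ → V) : Prop :=
  3 ≤ n ∧ c n = c 0 ∧ Set.InjOn c (Set.Iio n) ∧ ∀ i < n, G.Step (c i) (c (i + 1))

/-- `G` has girth `g`: it has a cycle, and the minimum length of a cycle is `g`. -/
def HasGirth {V : Type*} (G : MixedGraph V) (g : ℕ) : Prop :=
  IsLeast {n : ℕ | ∃ c : ℕ → V, G.IsCycle n c} g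

/-- Every vertex is the tail of `z` arcs, the head of `z` arcs, and is incident with `r` edges. -/
def IsRegular {V : Type*} (G : MixedGraph V) (z r : ℕ) : Prop :=
  ∀ v : V, {w | G.arc v w}.ncard = z ∧ {w | G.arc w v}.ncard = z ∧
    {w | G.edge.Adj v w}.ncard = r

/-- The set of orders of `[z, r; g]`-mixed graphs, i.e. of finite mixed graphs that are `z`-regular
by arcs, `r`-regular by edges and have girth `g`. -/
def orders (z r g : ℕ) : Set ℕ :=
  {N | ∃ (V : Type) (_ : Finite V) (G : MixedGraph V),
    G.IsRegular z r ∧ G.HasGirth g ∧ Nat.card V = N}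

/-- `n[z, r; g]`, the order of a `[z, r; g]`-mixed cage: the least order of a
`[z, r; g]`-mixed graph. It is meaningful when such graphs exist. -/
noncomputable def cageOrder (z r g : ℕ) : ℕ :=
  sInf (orders z r g)

end MixedGraph

/-! Replace "girth `g`" by "no cycle shorter than `g`". The key claim (`IsOrderGE.exists_lt`): for
`g ≥ 3`, a nonempty regular mixed graph without cycles shorter than `g + 1` yields a smaller one
without cycles shorter than `g`. So a smallest graph for the bound `g` has girth exactly `g`, and
the minimum order grows strictly with `g`.

For the claim, delete a vertex (`r` even) or both ends of an edge (`r` odd). At each deleted `s`,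
join every in-neighbour by an arc to one out-neighbour, and pair the surviving edge-neighbours by
new edges. Degrees are kept. A cycle through new links contains a stretch of old steps that closes
up in the old graph through one or two deleted vertices, at the cost of at most one extra step
(`graph_girthGE`).

The absence of triangles keeps the result simple, except that a new arc might repeat an old or
another new arc. The matchings at the deleted vertices must avoid this; a count of out-neighbours
and in-neighbours shows that no vertex is blocked completely, which suffices for `z ≤ 2`.

Graphs with no short cycles come from the product of a Cayley graph of involutions with a circulant
digraph. -/

namespace MixedGraph

/-! ### Girth bounds, triangles and rotation of cycles -/

variable {V : Type*}

/-- Every cycle of `G` has length at least `g`. -/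
def GirthGE (G : MixedGraph V) (g : ℕ) : Prop :=
  ∀ (n : ℕ) (c : ℕ → V), G.IsCycle n c → g ≤ n

theorem arc_ne (G : MixedGraph V) {u v : V} (h : G.arc u v) : u ≠ v := by
  rintro rfl
  exact G.arc_asymm _ _ h h

theorem Step.ne {G : MixedGraph V} {u v : V} (h : G.Step u v) : u ≠ v :=
  h.elim (fun h => h.ne) (G.arc_ne)

theorem GirthGE.mono {G : MixedGraph V} {g g' : ℕ} (h : G.GirthGE g) (hg : g' ≤ g) :
    G.GirthGE g' :=
  fun n c hc => hg.trans (h n c hc)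

/-- A mixed graph of girth at least four has no directed triangle. -/
theorem GirthGE.no_triangle {G : MixedGraph V} {g : ℕ} (h : G.GirthGE g) (hg : 4 ≤ g) {a b c : V}
    (hab : G.Step a b) (hbc : G.Step b c) (hca : G.Step c a) : False := by
  have := h 3 (fun i => if i = 1 then b else if i = 2 then c else a) ⟨le_rfl, by simp, ?_, ?_⟩
  · omega
  · have h1 := hab.ne
    have h2 := hbc.ne
    have h3 := hca.ne
    intro i hi j hj hij
    simp only [Set.mem_Iio] at hi hj
    interval_cases i <;> interval_cases j <;> simp_all
  · intro i hi
    interval_cases i <;> simpa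

/-- A cycle may be started at any of its vertices. -/
theorem IsCycle.rotate {G : MixedGraph V} {n : ℕ} {c : ℕ → V} (h : G.IsCycle n c) (k : ℕ) :
    G.IsCycle n (fun i => c ((i + k) % n)) := by
  obtain ⟨h3, hn, hinj, hst⟩ := h
  have hpos : 0 < n := by omega
  refine ⟨h3, by simp, ?_, ?_⟩
  · intro i hi j hj hij
    have := hinj (Set.mem_Iio.2 (Nat.mod_lt _ hpos)) (Set.mem_Iio.2 (Nat.mod_lt _ hpos)) hij
    exact Nat.ModEq.eq_of_lt_of_lt (Nat.ModEq.add_right_cancel' k this) hi hj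
  · intro i _
    have hlt : (i + k) % n < n := Nat.mod_lt _ hpos
    have hs := hst _ hlt
    have : c ((i + 1 + k) % n) = c ((i + k) % n + 1) := by
      rw [show i + 1 + k = i + k + 1 by ring, Nat.add_mod, Nat.mod_eq_of_lt (show 1 < n by omega)]
      rcases Nat.lt_or_ge ((i + k) % n + 1) n with h | h
      · rw [Nat.mod_eq_of_lt h]
      · rw [show (i + k) % n + 1 = n by omega, Nat.mod_self, hn]
    simpa only [this] using hs

end MixedGraph

/-! ### Matchings and pairings of finite sets -/

theorem Set.ncard_eq_of_existsUnique {α β : Type*} {s : Set α} {t : Set β} (T : α → β → Prop)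
    (h₁ : ∀ a ∈ s, ∃! b, b ∈ t ∧ T a b) (h₂ : ∀ b ∈ t, ∃! a, a ∈ s ∧ T a b) :
    s.ncard = t.ncard := by
  choose f hf using fun a ha => (h₁ a ha).exists
  refine Set.ncard_congr f (fun a ha => (hf a ha).1) ?_ ?_
  · intro a b ha hb hab
    refine (h₂ (f a ha) (hf a ha).1).unique ⟨ha, (hf a ha).2⟩ ⟨hb, ?_⟩
    have := (hf b hb).2
    rwa [← show f a ha = f b hb from hab] at this
  · intro b hb
    obtain ⟨a, ha, hT⟩ := (h₂ b hb).exists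
    exact ⟨a, ha, (h₁ a ha).unique (hf a ha) ⟨hb, hT⟩⟩

/-- `M` is (the graph of) a bijection from `P` to `Q`. -/
structure IsMatchingRel {α : Type*} (P Q : Set α) (M : α → α → Prop) : Prop where
  left_mem : ∀ p q, M p q → p ∈ P
  right_mem : ∀ p q, M p q → q ∈ Q
  left : ∀ p ∈ P, ∃! q, M p q
  right : ∀ q ∈ Q, ∃! p, M p q

theorem isMatchingRel_pair {α : Type*} {p₁ p₂ q₁ q₂ : α} (hp : p₁ ≠ p₂) (hq : q₁ ≠ q₂) :
    IsMatchingRel {p₁, p₂} {q₁, q₂} (fun p q => p = p₁ ∧ q = q₁ ∨ p = p₂ ∧ q = q₂) where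
  left_mem := by rintro p q (⟨rfl, -⟩ | ⟨rfl, -⟩) <;> simp
  right_mem := by rintro p q (⟨-, rfl⟩ | ⟨-, rfl⟩) <;> simp
  left := by
    rintro p (rfl | rfl)
    · exact ⟨q₁, by simp, by simp [hp]⟩
    · exact ⟨q₂, by simp, by simp [hp.symm]⟩
  right := by
    rintro p (rfl | rfl)
    · exact ⟨p₁, by simp, by simp [hq]⟩
    · exact ⟨p₂, by simp, by simp [hq.symm]⟩

/-- Two sets of the same size, one or two, have a perfect matching that avoids `E` if no element
is in relation `E` with the whole of the other set. -/
theorem exists_isMatchingRel {α : Type*} {P Q : Set α} {z : ℕ} (hz : z = 1 ∨ z = 2)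
    (hP : P.ncard = z) (hQ : Q.ncard = z) (E : α → α → Prop)
    (h₁ : ∀ p ∈ P, ∃ q ∈ Q, ¬ E p q) (h₂ : ∀ q ∈ Q, ∃ p ∈ P, ¬ E p q) :
    ∃ M, IsMatchingRel P Q M ∧ ∀ p q, M p q → ¬ E p q := by
  rcases hz with rfl | rfl
  · obtain ⟨p, rfl⟩ := Set.ncard_eq_one.1 hP
    obtain ⟨q, rfl⟩ := Set.ncard_eq_one.1 hQ
    have hE : ¬ E p q := by simpa using h₁ p rfl
    refine ⟨fun a b => a = p ∧ b = q, ⟨by simp, by simp, by simp, by simp⟩, ?_⟩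
    rintro _ _ ⟨rfl, rfl⟩
    exact hE
  · obtain ⟨p₁, p₂, hp, rfl⟩ := Set.ncard_eq_two.1 hP
    obtain ⟨q₁, q₂, hq, rfl⟩ := Set.ncard_eq_two.1 hQ
    simp only [Set.mem_insert_iff, Set.mem_singleton_iff, forall_eq_or_imp, forall_eq,
      exists_eq_or_imp, exists_eq_left] at h₁ h₂
    -- If one straight pair is forbidden, both crossed pairs are allowed, since no element is
    -- blocked from the whole other side.
    by_cases h : E p₁ q₁ ∨ E p₂ q₂
    · refine ⟨_, Set.pair_comm q₁ q₂ ▸ isMatchingRel_pair hp hq.symm, ?_⟩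
      rintro p q (⟨rfl, rfl⟩ | ⟨rfl, rfl⟩) <;> tauto
    · refine ⟨_, isMatchingRel_pair hp hq, ?_⟩
      rintro p q (⟨rfl, rfl⟩ | ⟨rfl, rfl⟩) <;> tauto

/-- A finite set of even size splits into pairs. -/
theorem exists_pairing {α : Type*} {U : Set α} (hfin : U.Finite) (hU : Even U.ncard) :
    ∃ B : α → α → Prop, (∀ u v, B u v → B v u) ∧ (∀ u v, B u v → u ∈ U) ∧ (∀ u, ¬ B u u) ∧
      ∀ u ∈ U, ∃! v, B u v := by
  obtain ⟨k, hk⟩ := hU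
  have := hfin.to_subtype
  obtain ⟨e⟩ : Nonempty (U ≃ Fin k × Bool) := by
    rw [← Finite.card_eq]
    rw [Nat.card_coe_set_eq, hk]; simp; ring
  refine ⟨fun u v => ∃ (hu : u ∈ U) (hv : v ∈ U), (e ⟨u, hu⟩).1 = (e ⟨v, hv⟩).1 ∧
    (e ⟨u, hu⟩).2 ≠ (e ⟨v, hv⟩).2, ?_, ?_, ?_, ?_⟩
  · rintro u v ⟨hu, hv, h₁, h₂⟩
    exact ⟨hv, hu, h₁.symm, h₂.symm⟩
  · rintro u v ⟨hu, -⟩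
    exact hu
  · rintro u ⟨hu, hv, -, h⟩
    exact h rfl
  · intro u hu
    refine ⟨e.symm ((e ⟨u, hu⟩).1, !(e ⟨u, hu⟩).2), ⟨hu, Subtype.coe_prop _, by simp⟩, ?_⟩
    rintro v ⟨_, hv, h₁, h₂⟩
    have : (⟨v, hv⟩ : U) = e.symm ((e ⟨u, hu⟩).1, !(e ⟨u, hu⟩).2) := by
      rw [Equiv.eq_symm_apply, Prod.ext_iff]
      refine ⟨h₁.symm, ?_⟩
      revert h₂
      cases (e ⟨u, hu⟩).2 <;> cases (e ⟨v, hv⟩).2 <;> simp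
    exact congrArg Subtype.val this
-- Deleting a clique and reconnecting its neighbours
namespace MixedGraph
variable {V : Type*}

/-- Data for removing the clique `S` from `G` while keeping the degrees: for each `s ∈ S`, the arcs
into `s` are matched with those out of `s`, and the neighbours of `s` outside `S` are paired. -/
structure Splitting (G : MixedGraph V) (S : Set V) (A B : V → V → V → Prop) : Prop where
  clique : ∀ s ∈ S, ∀ t ∈ S, s ≠ t → G.edge.Adj s t
  matching : ∀ s ∈ S, IsMatchingRel {p | G.arc p s} {q | G.arc s q} (A s)
  arc_mem : ∀ s p q, A s p q → s ∈ S
  -- This condition and the next exclude repeated arcs. They must be required: `p → s → q` with `p →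
  -- q`, or with `p → t → q`, need not contain a directed triangle. All other clashes do.
  arc_new : ∀ s p q, A s p q → ¬ G.arc p q
  arc_inj : ∀ s t p q, A s p q → A t p q → s = t
  edge_mem : ∀ s u v, B s u v → s ∈ S
  edge_symm : ∀ s u v, B s u v → B s v u
  edge_irrefl : ∀ s u, ¬ B s u u
  edge_adj : ∀ s u v, B s u v → G.edge.Adj s u
  edge_notMem : ∀ s u v, B s u v → u ∉ S
  edge_unique : ∀ s ∈ S, ∀ u, G.edge.Adj s u → u ∉ S → ∃! v, B s u v

namespace Splitting

variable {G : MixedGraph V} {S : Set V} {A B : V → V → V → Prop} {g : ℕ}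

theorem arc_left (h : G.Splitting S A B) {s p q : V} (hA : A s p q) : G.arc p s :=
  (h.matching s (h.arc_mem s p q hA)).left_mem p q hA

theorem arc_right (h : G.Splitting S A B) {s p q : V} (hA : A s p q) : G.arc s q :=
  (h.matching s (h.arc_mem s p q hA)).right_mem p q hA

theorem notMem_of_arc_to (h : G.Splitting S A B) {s p : V} (hs : s ∈ S) (hp : G.arc p s) :
    p ∉ S := by
  intro hpS
  exact G.arc_not_edge _ _ hp (h.clique p hpS s hs (G.arc_ne hp))

theorem notMem_of_arc_from (h : G.Splitting S A B) {s q : V} (hs : s ∈ S) (hq : G.arc s q) :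
    q ∉ S := by
  intro hqS
  exact G.arc_not_edge _ _ hq (h.clique s hs q hqS (G.arc_ne hq))

theorem edge_adj' (h : G.Splitting S A B) {s u v : V} (hB : B s u v) : G.edge.Adj s v :=
  h.edge_adj s v u (h.edge_symm s u v hB)

theorem arc_steps (h : G.Splitting S A B) {s p q : V} (hA : A s p q) :
    G.Step p s ∧ G.Step s q :=
  ⟨Or.inr (h.arc_left hA), Or.inr (h.arc_right hA)⟩

theorem edge_steps (h : G.Splitting S A B) {s u v : V} (hB : B s u v) :
    G.Step u s ∧ G.Step s v :=
  ⟨Or.inl (h.edge_adj s u v hB).symm, Or.inl (h.edge_adj' hB)⟩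

/-- A path of length two through `S` does not close up to a directed triangle. -/
theorem no_step_back (_ : G.Splitting S A B) (hG : G.GirthGE g) (hg : 4 ≤ g) {s u v : V}
    (hs : G.Step u s ∧ G.Step s v) : ¬ G.Step v u :=
  fun hvu => hG.no_triangle hg hs.1 hs.2 hvu

/-- Paths `u → s → v` and `v → t → u` with `s, t ∈ S` have `s = t`. -/
theorem eq_of_steps (h : G.Splitting S A B) (hG : G.GirthGE g) (hg : 4 ≤ g) {s t v : V}
    (hs : s ∈ S) (ht : t ∈ S) (hsv : G.Step s v) (hvt : G.Step v t) : s = t := by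
  by_contra hne
  exact hG.no_triangle hg hsv hvt (Or.inl (h.clique t ht s hs (Ne.symm hne)))

/-- The mixed graph obtained by removing `S` and adding the new arcs and edges. -/
def graph (h : G.Splitting S A B) (hG : G.GirthGE g) (hg : 4 ≤ g) :
    MixedGraph (Sᶜ : Set V) where
  edge :=
    { Adj := fun u v => G.edge.Adj u v ∨ ∃ s, B s u v
      symm := ⟨by
        rintro u v (huv | ⟨s, hs⟩)
        · exact Or.inl huv.symm
        · exact Or.inr ⟨s, h.edge_symm _ _ _ hs⟩⟩
      loopless := ⟨by
        rintro u (huv | ⟨s, hs⟩)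
        · exact huv.ne rfl
        · exact h.edge_irrefl _ _ hs⟩ }
  arc := fun u v => G.arc u v ∨ ∃ s, A s u v
  arc_asymm := by
    rintro u v (huv | ⟨s, hs⟩) (hvu | ⟨t, ht⟩)
    · exact G.arc_asymm _ _ huv hvu
    · exact h.no_step_back hG hg (h.arc_steps ht) (Or.inr huv)
    · exact h.no_step_back hG hg (h.arc_steps hs) (Or.inr hvu)
    · have := h.eq_of_steps hG hg (h.arc_mem _ _ _ hs) (h.arc_mem _ _ _ ht) (h.arc_steps hs).2
        (h.arc_steps ht).1
      subst this
      exact G.arc_asymm _ _ (h.arc_left hs) (h.arc_right ht)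
  arc_not_edge := by
    rintro u v (huv | ⟨s, hs⟩) (hvu | ⟨t, ht⟩)
    · exact G.arc_not_edge _ _ huv hvu
    · exact h.no_step_back hG hg (h.edge_steps (h.edge_symm _ _ _ ht)) (Or.inr huv)
    · exact h.no_step_back hG hg (h.arc_steps hs) (Or.inl hvu.symm)
    · have := h.eq_of_steps hG hg (h.arc_mem _ _ _ hs) (h.edge_mem _ _ _ ht) (h.arc_steps hs).2
        (Or.inl (h.edge_adj' ht).symm)
      subst this
      exact G.arc_not_edge _ _ (h.arc_left hs) (h.edge_adj _ _ _ ht).symm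

/-- Replacing in a neighbourhood each `s ∈ S` by its partner does not change the size. -/
theorem ncard_replace {N : Set V} (C : V → V → Prop)
    (hC : ∀ s ∈ N, s ∈ S → ∃! w, C s w) (hS : ∀ s w, C s w → w ∉ S ∧ w ∉ N ∧ s ∈ N ∧ s ∈ S)
    (hinj : ∀ s t w, C s w → C t w → s = t) :
    {w : (Sᶜ : Set V) | w.1 ∈ N ∨ ∃ s, C s w}.ncard = N.ncard := by
  symm
  refine Set.ncard_eq_of_existsUnique (fun u w => u = w.1 ∨ C u w) ?_ ?_
  · intro u hu
    by_cases huS : u ∈ S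
    · obtain ⟨w, hw, huniq⟩ := hC u hu huS
      refine ⟨⟨w, (hS u w hw).1⟩, ⟨Or.inr ⟨u, hw⟩, Or.inr hw⟩, ?_⟩
      rintro ⟨w', hw'S⟩ ⟨-, rfl | hw'⟩
      · exact absurd huS hw'S
      · exact Subtype.ext (huniq _ hw')
    · refine ⟨⟨u, huS⟩, ⟨Or.inl hu, Or.inl rfl⟩, ?_⟩
      rintro ⟨w', hw'S⟩ ⟨-, rfl | hw'⟩
      · rfl
      · exact absurd (hS _ _ hw').2.2.2 huS
  · rintro ⟨w, hwS⟩ (hw | ⟨s, hs⟩)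
    · refine ⟨w, ⟨hw, Or.inl rfl⟩, ?_⟩
      rintro u ⟨-, hu | hu⟩
      · exact hu
      · exact absurd hw (hS _ _ hu).2.1
    · refine ⟨s, ⟨(hS _ _ hs).2.2.1, Or.inr hs⟩, ?_⟩
      rintro u ⟨hu, rfl | hu'⟩
      · exact absurd hu (hS _ _ hs).2.1
      · exact hinj _ _ _ hu' hs

/-- A surviving vertex exchanges each lost neighbour `s ∈ S` for its partner at `s`. The partner was
not yet such a neighbour: by `arc_new` for arcs, by the absence of triangles for edges. -/
theorem graph_isRegular (h : G.Splitting S A B) (hG : G.GirthGE g) (hg : 4 ≤ g) {z r : ℕ}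
    (hreg : G.IsRegular z r) : (h.graph hG hg).IsRegular z r := by
  rintro ⟨v, hv⟩
  obtain ⟨h₁, h₂, h₃⟩ := hreg v
  refine ⟨?_, ?_, ?_⟩
  · rw [← h₁]
    refine ncard_replace (N := {w | G.arc v w}) (fun s w => A s v w) ?_ ?_ ?_
    · intro s hs hsS
      exact (h.matching s hsS).left v hs
    · intro s w hw
      have hsS := h.arc_mem _ _ _ hw
      exact ⟨h.notMem_of_arc_from hsS (h.arc_right hw), h.arc_new _ _ _ hw, h.arc_left hw, hsS⟩
    · intro s t w
      exact h.arc_inj s t v w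
  · rw [← h₂]
    refine ncard_replace (N := {w | G.arc w v}) (fun s w => A s w v) ?_ ?_ ?_
    · intro s hs hsS
      exact (h.matching s hsS).right v hs
    · intro s w hw
      have hsS := h.arc_mem _ _ _ hw
      exact ⟨h.notMem_of_arc_to hsS (h.arc_left hw), h.arc_new _ _ _ hw, h.arc_right hw, hsS⟩
    · intro s t w
      exact h.arc_inj s t w v
  · rw [← h₃]
    refine ncard_replace (N := {w | G.edge.Adj v w}) (fun s w => B s v w) ?_ ?_ ?_
    · intro s hs hsS
      exact h.edge_unique s hsS v (SimpleGraph.Adj.symm hs) hv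
    · intro s w hw
      refine ⟨h.edge_notMem _ _ _ (h.edge_symm _ _ _ hw), fun hvw => ?_,
        (h.edge_adj _ _ _ hw).symm, h.edge_mem _ _ _ hw⟩
      exact h.no_step_back hG hg (h.edge_steps hw) (Or.inl (SimpleGraph.Adj.symm hvw))
    · intro s t w hs ht
      exact h.eq_of_steps hG hg (h.edge_mem _ _ _ hs) (h.edge_mem _ _ _ ht) (h.edge_steps hs).2
        (h.edge_steps (h.edge_symm _ _ _ ht)).1

/-- Going through the same `s` twice in succession means turning back along a new edge. -/
theorem eq_of_consecutive (h : G.Splitting S A B) {s u v w : V} (huv : A s u v ∨ B s u v)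
    (hvw : A s v w ∨ B s v w) : u = w := by
  -- Both links use the single edge or arc between `s` and `v`, which excludes every case but two
  -- new edges; there the partner of `v` at `s` is unique.
  rcases huv with huv | huv <;> rcases hvw with hvw | hvw
  · exact absurd (h.arc_left hvw) (G.arc_asymm _ _ (h.arc_right huv))
  · exact absurd (h.edge_adj _ _ _ hvw) (G.arc_not_edge _ _ (h.arc_right huv))
  · exact absurd (h.edge_adj' huv).symm (G.arc_not_edge _ _ (h.arc_left hvw))
  · exact (h.edge_unique s (h.edge_mem _ _ _ huv) v (h.edge_adj' huv)
      (h.edge_notMem _ _ _ hvw)).unique (h.edge_symm _ _ _ huv) hvw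

theorem steps (h : G.Splitting S A B) {s u v : V} (huv : A s u v ∨ B s u v) :
    s ∈ S ∧ G.Step u s ∧ G.Step s v :=
  huv.elim (fun hA => ⟨h.arc_mem _ _ _ hA, h.arc_steps hA⟩)
    (fun hB => ⟨h.edge_mem _ _ _ hB, h.edge_steps hB⟩)

theorem step_cases (h : G.Splitting S A B) (hG : G.GirthGE g) (hg : 4 ≤ g) {u v : (Sᶜ : Set V)}
    (huv : (h.graph hG hg).Step u v) : G.Step u v ∨ ∃ s, A s u v ∨ B s u v := by
  rcases huv with (h' | ⟨s, h'⟩) | (h' | ⟨s, h'⟩)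
  · exact Or.inl (Or.inl h')
  · exact Or.inr ⟨s, Or.inr h'⟩
  · exact Or.inl (Or.inr h')
  · exact Or.inr ⟨s, Or.inl h'⟩

/-- A path of `G` outside `S` whose ends are joined to `s` closes up to a cycle. -/
theorem isCycle_one {c : ℕ → V} {j : ℕ} {s : V} (hj : 1 ≤ j) (hinj : Set.InjOn c (Set.Iic j))
    (hcs : ∀ i ≤ j, c i ≠ s) (hst : ∀ i < j, G.Step (c i) (c (i + 1))) (h0 : G.Step s (c 0))
    (h1 : G.Step (c j) s) : G.IsCycle (j + 2) (fun i => if i ≤ j then c i else if i = j + 1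
      then s else c 0) := by
  refine ⟨by omega, by simp, ?_, ?_⟩
  · intro a ha b hb hab
    simp only [Set.mem_Iio] at ha hb
    simp only at hab
    split_ifs at hab with h₁ h₂ h₃ h₄ <;> first | omega | skip
    · exact hinj h₁ h₂ hab
    · exact absurd hab (hcs _ h₁)
    · exact absurd hab.symm (hcs _ (by assumption))
  · intro i hi
    rcases lt_trichotomy i j with h | rfl | h
    · simpa [h.le, Nat.succ_le_of_lt h] using hst i h
    · simpa using h1
    · obtain rfl : i = j + 1 := by omega
      simpa using h0

/-- A path of `G` outside `S` from a successor of `s` to a predecessor of `t`, where `t` is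
joined to `s`, closes up to a cycle. -/
theorem isCycle_two {c : ℕ → V} {j : ℕ} {s t : V} (hinj : Set.InjOn c (Set.Iic j))
    (hcs : ∀ i ≤ j, c i ≠ s) (hct : ∀ i ≤ j, c i ≠ t)
    (hst : ∀ i < j, G.Step (c i) (c (i + 1))) (h0 : G.Step s (c 0))
    (h1 : G.Step (c j) t) (hts : G.Step t s) : G.IsCycle (j + 3) (fun i => if i ≤ j then c i
      else if i = j + 1 then t else if i = j + 2 then s else c 0) := by
  have hne := hts.ne
  refine ⟨by omega, by simp, ?_, ?_⟩
  · intro a ha b hb hab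
    simp only [Set.mem_Iio] at ha hb
    simp only at hab
    split_ifs at hab <;> first | omega | skip
    · exact hinj (by assumption) (by assumption) hab
    · exact absurd hab (hct _ (by assumption))
    · exact absurd hab (hcs _ (by assumption))
    · exact absurd hab.symm (hct _ (by assumption))
    · exact absurd hab hne
    · exact absurd hab.symm (hcs _ (by assumption))
    · exact absurd hab.symm hne
  · intro i hi
    rcases lt_trichotomy i j with h | rfl | h
    · simpa [h.le, Nat.succ_le_of_lt h] using hst i h
    · simpa using h1
    · obtain rfl | rfl : i = j + 1 ∨ i = j + 2 := by omega
      · simpa using hts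
      · simpa using h0

theorem graph_girthGE (h : G.Splitting S A B) (hG : G.GirthGE (g + 1)) (hg : 4 ≤ g + 1) :
    (h.graph hG hg).GirthGE g := by
  intro n c hc
  by_cases hold : ∀ i < n, G.Step (c i) (c (i + 1))
  · have := hG n (fun i => c i) ⟨hc.1, congrArg Subtype.val hc.2.1, fun i hi j hj hij =>
      hc.2.2.1 hi hj (Subtype.ext hij), hold⟩
    omega
  push Not at hold
  obtain ⟨k, hk, hnew⟩ := hold
  -- Rotate so that the closing step, from `d (n - 1)` to `d n = d 0`, is new.
  have hrot := hc.rotate (k + 1)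
  set d : ℕ → (Sᶜ : Set V) := fun i => c ((i + (k + 1)) % n) with hd
  have hlast : ¬ G.Step (d (n - 1)) (d n) := by
    have h1 : d (n - 1) = c k := by
      simp only [hd]
      rw [show n - 1 + (k + 1) = k + n by omega, Nat.add_mod_right, Nat.mod_eq_of_lt hk]
    have h2 : d n = c (k + 1) := by
      simp only [hd]
      rw [Nat.add_mod_left]
      rcases Nat.lt_or_ge (k + 1) n with h | h
      · rw [Nat.mod_eq_of_lt h]
      · rw [show k + 1 = n by omega, Nat.mod_self, hc.2.1]
    rwa [h1, h2]
  clear_value d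
  clear hd hnew hk k hc c
  obtain ⟨h3, hn, hinj, hst⟩ := hrot
  have hlast' := (h.step_cases hG hg (hst (n - 1) (by omega)))
  rw [Nat.sub_add_cancel (by omega)] at hlast'
  obtain ⟨s, hs⟩ := hlast'.resolve_left hlast
  rw [hn] at hs
  classical
  have hex : ∃ j, j < n ∧ ¬ G.Step (d j) (d (j + 1)) :=
    ⟨n - 1, by omega, by rwa [Nat.sub_add_cancel (by omega)]⟩
  -- With `j` the first new step, `d 0, …, d j` is a path of old steps, entered from `s` and left
  -- towards some `t` in `S`.
  obtain ⟨j, ⟨hjn, hj⟩, hmin⟩ : ∃ j, (j < n ∧ ¬ G.Step (d j) (d (j + 1))) ∧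
      ∀ i < j, G.Step (d i) (d (i + 1)) := by
    refine ⟨Nat.find hex, Nat.find_spec hex, fun i hi => ?_⟩
    have h1 := Nat.find_min hex hi
    have h2 := (Nat.find_spec hex).1
    push Not at h1
    exact h1 (by omega)
  have hpinj : Set.InjOn (fun i => (d i : V)) (Set.Iic j) := by
    intro a ha b hb hab
    exact hinj (Set.mem_Iio.2 (lt_of_le_of_lt ha hjn)) (Set.mem_Iio.2 (lt_of_le_of_lt hb hjn))
      (Subtype.ext hab)
  have havoid : ∀ t ∈ S, ∀ i ≤ j, (d i : V) ≠ t := by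
    rintro t ht i - rfl
    exact (d i).2 ht
  obtain ⟨hsS, -, hs0⟩ := h.steps hs
  -- If the first new step is also the last, take the same deleted vertex. Hence `t ≠ s` forces `j ≤
  -- n - 2`, which pays for the second deleted vertex in the cycle of length `j + 3`.
  obtain ⟨t, ht, htn⟩ : ∃ t, (A t (d j) (d (j + 1)) ∨ B t (d j) (d (j + 1))) ∧
      (j = n - 1 → t = s) := by
    by_cases hjl : j = n - 1
    · refine ⟨s, ?_, fun _ => rfl⟩
      rw [hjl, Nat.sub_add_cancel (by omega), hn]
      exact hs
    · obtain ⟨t, ht⟩ := (h.step_cases hG hg (hst j hjn)).resolve_left hj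
      exact ⟨t, ht, fun h => absurd h hjl⟩
  obtain ⟨htS, hjt, -⟩ := h.steps ht
  by_cases hts : t = s
  · subst hts
    have hj1 : 1 ≤ j := by
      by_contra hj0
      obtain rfl : j = 0 := by omega
      have := hinj (Set.mem_Iio.2 (by omega)) (Set.mem_Iio.2 (by omega))
        (Subtype.ext (h.eq_of_consecutive hs ht))
      omega
    have := hG _ _ (isCycle_one hj1 hpinj (havoid t htS) hmin hs0 hjt)
    omega
  · have := hG _ _ (isCycle_two hpinj (havoid s hsS) (havoid t htS) hmin hs0 hjt
      (Or.inl (h.clique t htS s hsS hts)))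
    have : j ≠ n - 1 := fun h => hts (htn h)
    omega

end Splitting

end MixedGraph
-- Regular mixed graphs without short cycles
namespace MixedGraph

/-- Put `j` in front of a word, or cancel it there; words of length `L` are not made longer. -/
def toggle {r : ℕ} (L : ℕ) (j : Fin r) (l : List (Fin r)) : List (Fin r) :=
  if l.head? = some j then l.tail else if l.length < L then j :: l else l

/-- The words of length at most `L` over `Fin r` in which neighbouring letters differ. -/
abbrev ReducedWord (r L : ℕ) : Type :=
  {l : List (Fin r) // l.length ≤ L ∧ l.IsChain (· ≠ ·)}

theorem toggle_mem {r L : ℕ} (j : Fin r) {l : List (Fin r)}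
    (hl : l.length ≤ L ∧ l.IsChain (· ≠ ·)) :
    (toggle L j l).length ≤ L ∧ (toggle L j l).IsChain (· ≠ ·) := by
  unfold toggle
  split_ifs with h h'
  · exact ⟨by simp; omega, hl.2.tail⟩
  · refine ⟨h', ?_⟩
    rw [List.isChain_cons]
    refine ⟨?_, hl.2⟩
    rintro y hy rfl
    exact h hy
  · exact hl

/-- After a cancellation the new first letter differs from `j`, because the word is reduced, so `j`
is put back. A word of length `L` not starting with `j` is fixed. -/
theorem toggle_toggle {r L : ℕ} (j : Fin r) {l : List (Fin r)}
    (hl : l.length ≤ L ∧ l.IsChain (· ≠ ·)) : toggle L j (toggle L j l) = l := by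
  cases l with
  | nil => by_cases h : 0 < L <;> simp [toggle, h]
  | cons a l =>
    by_cases h : a = j
    · subst h
      have h1 : l.head? ≠ some a := by
        intro h
        exact (List.isChain_cons.1 hl.2).1 a h rfl
      have h2 : l.length < L := by simpa using hl.1
      simp [toggle, h1, h2]
    · by_cases h' : l.length + 1 < L <;> simp [toggle, h, h']

/-- The involution of the reduced words given by `toggle`. -/
def togglePerm {r : ℕ} (L : ℕ) (j : Fin r) : Equiv.Perm (ReducedWord r L) :=
  Function.Involutive.toPerm (fun w => ⟨toggle L j w.1, toggle_mem j w.2⟩)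
    (fun w => Subtype.ext (toggle_toggle j w.2))

theorem togglePerm_mul_self {r L : ℕ} (j : Fin r) (σ : Equiv.Perm (ReducedWord r L)) :
    togglePerm L j * (togglePerm L j * σ) = σ := by
  ext1 w
  exact Subtype.ext (toggle_toggle j (σ w).2)

/-- The empty word. -/
def emptyWord (r L : ℕ) : ReducedWord r L := ⟨[], by simp⟩

theorem togglePerm_emptyWord {r L : ℕ} (hL : 0 < L) (j : Fin r) :
    (togglePerm L j (emptyWord r L)).1 = [j] := by
  simp [togglePerm, emptyWord, toggle, hL]

theorem togglePerm_injective {r L : ℕ} (hL : 0 < L) :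
    Function.Injective (togglePerm (r := r) L) := by
  intro i j h
  have := togglePerm_emptyWord hL i
  rw [h, togglePerm_emptyWord hL j] at this
  simpa using this.symm

theorem togglePerm_mul_ne {r L : ℕ} (hL : 0 < L) (j : Fin r)
    (σ : Equiv.Perm (ReducedWord r L)) : togglePerm L j * σ ≠ σ := by
  intro h
  have h1 : togglePerm L j = 1 := mul_eq_right.1 h
  have := togglePerm_emptyWord hL j
  rw [h1] at this
  simp [emptyWord] at this

/-- Multiplying in turn by `n ≤ L` involutions, each different from the one before, does not lead
back to the starting point. -/
theorem length_of_togglePerm_walk {r L n : ℕ} (hn : n ≤ L)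
    (s : ℕ → Equiv.Perm (ReducedWord r L)) (j : ℕ → Fin r)
    (hs : ∀ i < n, s (i + 1) = togglePerm L (j i) * s i)
    (hj : ∀ i, i + 1 < n → j i ≠ j (i + 1)) :
    ∀ i ≤ n, (s i ((s 0)⁻¹ (emptyWord r L))).1.length = i ∧
      ∀ k, k + 1 = i → (s i ((s 0)⁻¹ (emptyWord r L))).1.head? = some (j k) := by
  -- Evaluating at `(s 0)⁻¹ []` starts from the empty word. The first letter is always the last one
  -- used, so the next letter never cancels and the word grows.
  intro i
  induction i with
  | zero => intro _; simp [emptyWord]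
  | succ i ih =>
    intro hi
    obtain ⟨h1, h2⟩ := ih (by omega)
    have hv : (s (i + 1) ((s 0)⁻¹ (emptyWord r L))).1 =
        toggle L (j i) (s i ((s 0)⁻¹ (emptyWord r L))).1 := by
      rw [hs i (by omega)]; rfl
    have hhead : (s i ((s 0)⁻¹ (emptyWord r L))).1.head? ≠ some (j i) := by
      cases i with
      | zero =>
        rw [List.length_eq_zero_iff.1 h1]; simp
      | succ k =>
        rw [h2 k rfl]
        simpa using hj k (by omega)
    rw [hv, toggle, if_neg hhead, if_pos (by omega)]
    refine ⟨congrArg Nat.succ h1, ?_⟩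
    rintro k hk
    rw [Nat.succ_injective hk]
    rfl

/-- The product of the Cayley graph of the involutions `togglePerm` with the circulant digraph on
`ZMod m` with jumps `1, …, z`. -/
def cayley (z r L m : ℕ) (hL : 0 < L) (hm : 2 * z < m) :
    MixedGraph (Equiv.Perm (ReducedWord r L) × ZMod m) where
  edge :=
    { Adj := fun u v => (∃ j, v.1 = togglePerm L j * u.1) ∧ v.2 = u.2
      symm := ⟨by
        rintro u v ⟨⟨j, hj⟩, h⟩
        exact ⟨⟨j, by rw [hj, togglePerm_mul_self]⟩, h.symm⟩⟩
      loopless := ⟨by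
        rintro u ⟨⟨j, hj⟩, -⟩
        exact togglePerm_mul_ne hL j _ hj.symm⟩ }
  arc := fun u v => v.1 = u.1 ∧ ∃ i : Fin z, v.2 = u.2 + ((i + 1 : ℕ) : ZMod m)
  arc_asymm := by
    rintro u v ⟨-, i, hi⟩ ⟨-, k, hk⟩
    -- Two jumps add up to a positive number at most `2 * z < m`, hence not to zero modulo `m`.
    rw [hi, add_assoc, left_eq_add, ← Nat.cast_add, ZMod.natCast_eq_zero_iff] at hk
    have := Nat.le_of_dvd (by omega) hk
    omega
  arc_not_edge := by
    rintro u v ⟨h, -⟩ ⟨⟨j, hj⟩, -⟩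
    rw [h] at hj
    exact togglePerm_mul_ne hL j _ hj.symm

theorem natCast_succ_injective {z m : ℕ} (hm : z < m) :
    Function.Injective (fun i : Fin z => ((i + 1 : ℕ) : ZMod m)) := by
  intro i k h
  have h' := (ZMod.natCast_eq_natCast_iff _ _ _).1 h
  have := Nat.ModEq.eq_of_lt_of_lt h' (by omega) (by omega)
  ext
  omega

theorem ncard_of_eq_range {α : Type*} {n : ℕ} {s : Set α} (f : Fin n → α)
    (hf : Function.Injective f) (hs : s = Set.range f) : s.ncard = n := by
  rw [hs, ← Set.image_univ, Set.ncard_image_of_injective _ hf, Set.ncard_univ, Nat.card_fin]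

theorem cayley_isRegular (z r L m : ℕ) (hL : 0 < L) (hm : 2 * z < m) :
    (cayley z r L m hL hm).IsRegular z r := by
  have hinj := natCast_succ_injective (show z < m by omega)
  intro v
  refine ⟨?_, ?_, ?_⟩
  · refine ncard_of_eq_range (fun i : Fin z => (v.1, v.2 + ((i + 1 : ℕ) : ZMod m))) ?_ ?_
    · intro i k h
      exact hinj (add_left_cancel (congrArg Prod.snd h))
    · ext w
      simp only [cayley, Set.mem_ofPred_eq, Set.mem_range, Prod.ext_iff]
      constructor
      · rintro ⟨h, i, hi⟩; exact ⟨i, h.symm, hi.symm⟩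
      · rintro ⟨i, h, hi⟩; exact ⟨h.symm, i, hi.symm⟩
  · refine ncard_of_eq_range (fun i : Fin z => (v.1, v.2 - ((i + 1 : ℕ) : ZMod m))) ?_ ?_
    · intro i k h
      exact hinj (sub_right_injective (congrArg Prod.snd h))
    · ext w
      simp only [cayley, Set.mem_ofPred_eq, Set.mem_range, Prod.ext_iff]
      constructor
      · rintro ⟨h, i, hi⟩; exact ⟨i, h, by rw [hi]; ring⟩
      · rintro ⟨i, h, hi⟩; exact ⟨h, i, by rw [← hi]; ring⟩
  · refine ncard_of_eq_range (fun j : Fin r => (togglePerm L j * v.1, v.2)) ?_ ?_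
    · intro i k h
      exact togglePerm_injective hL (mul_right_cancel (congrArg Prod.fst h))
    · ext w
      simp only [cayley, Set.mem_ofPred_eq, Set.mem_range, Prod.ext_iff]
      constructor
      · rintro ⟨⟨j, hj⟩, h⟩; exact ⟨j, hj.symm, h.symm⟩
      · rintro ⟨j, hj, h⟩; exact ⟨⟨j, hj.symm⟩, h.symm⟩

/-- In a cycle of length `n ≤ L` the jumps sum to at most `z * L < m`, so no arc occurs. Distinct
vertices prevent using the same involution twice in succession, so the walk sends the empty word to
one of length `n`, and cannot close. -/
theorem cayley_lt_of_isCycle {z r L m : ℕ} (hL : 0 < L) (hm : 2 * z < m) (hLm : z * L < m)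
    {n : ℕ} {c : ℕ → Equiv.Perm (ReducedWord r L) × ZMod m}
    (hc : (cayley z r L m hL hm).IsCycle n c) : L < n := by
  by_contra hlt
  push Not at hlt
  obtain ⟨h3, hn, hinj, hst⟩ := hc
  have hd : ∀ i, ∃ d : ℕ, d ≤ z ∧ (i < n → (c (i + 1)).2 = (c i).2 + (d : ZMod m) ∧
      (d = 0 → ∃ j, (c (i + 1)).1 = togglePerm L j * (c i).1)) := by
    intro i
    by_cases hi : i < n
    · rcases hst i hi with ⟨h, h'⟩ | ⟨h, k, hk⟩
      · exact ⟨0, Nat.zero_le _, fun _ => ⟨by simpa using h', fun _ => h⟩⟩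
      · exact ⟨k + 1, k.2, fun _ => ⟨hk, by omega⟩⟩
    · exact ⟨0, Nat.zero_le _, fun h => absurd h hi⟩
  choose d hdz hd using hd
  have hsum : ∀ k ≤ n, (c k).2 = (c 0).2 + ((∑ i ∈ Finset.range k, d i : ℕ) : ZMod m) := by
    intro k
    induction k with
    | zero => simp
    | succ k ih =>
      intro hk
      rw [(hd k (by omega)).1, ih (by omega), Finset.sum_range_succ, Nat.cast_add, add_assoc]
  have h0 := hsum n le_rfl
  rw [hn, left_eq_add, ZMod.natCast_eq_zero_iff] at h0
  have hle : ∑ i ∈ Finset.range n, d i ≤ z * L := by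
    calc ∑ i ∈ Finset.range n, d i ≤ ∑ i ∈ Finset.range n, z := Finset.sum_le_sum fun i _ => hdz i
      _ = z * n := by simp [mul_comm]
      _ ≤ z * L := Nat.mul_le_mul_left _ hlt
  have hzero := Nat.eq_zero_of_dvd_of_lt h0 (by omega)
  rw [Finset.sum_eq_zero_iff] at hzero
  have hj : ∀ i, ∃ j, i < n → (c (i + 1)).1 = togglePerm L j * (c i).1 := by
    intro i
    by_cases hi : i < n
    · obtain ⟨j, hj⟩ := (hd i hi).2 (hzero i (Finset.mem_range.2 hi))
      exact ⟨j, fun _ => hj⟩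
    -- `Fin r` could be empty, so the default letter is borrowed from step `0`.
    · obtain ⟨j, -⟩ := (hd 0 (by omega)).2 (hzero 0 (Finset.mem_range.2 (by omega)))
      exact ⟨j, fun h => absurd h hi⟩
  choose j hj using hj
  have hne : ∀ i, i + 1 < n → j i ≠ j (i + 1) := by
    intro i hi he
    have h1 : (c (i + 1 + 1)).1 = (c i).1 := by
      rw [hj (i + 1) hi, hj i (by omega), he, togglePerm_mul_self]
    have h2 : (c (i + 1 + 1)).2 = (c i).2 := by
      rw [(hd (i + 1) hi).1, (hd i (by omega)).1, hzero i (Finset.mem_range.2 (by omega)),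
        hzero (i + 1) (Finset.mem_range.2 hi)]
      simp
    have h12 : c (i + 1 + 1) = c i := Prod.ext h1 h2
    rcases Nat.lt_or_ge (i + 1 + 1) n with h | h
    · have := hinj (Set.mem_Iio.2 h) (Set.mem_Iio.2 (by omega)) h12
      omega
    · rw [show i + 1 + 1 = n by omega, hn] at h12
      have := hinj (Set.mem_Iio.2 (by omega)) (Set.mem_Iio.2 (by omega)) h12
      omega
  have := (length_of_togglePerm_walk hlt (fun i => (c i).1) j hj hne n le_rfl).1
  rw [hn] at this
  simp [emptyWord] at this
  omega

theorem finite_reducedWord (r L : ℕ) : Finite (ReducedWord r L) :=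
  ((List.finite_length_le (Fin r) L).subset fun _ h => h.1).to_subtype

end MixedGraph
-- Choosing the new arcs and edges
namespace MixedGraph
variable {V : Type*}

/-- The arcs at `x` can be matched avoiding the arcs of `G` and a given matching `E` of the
arcs at a vertex `y` that is joined to `x` by an edge. -/
theorem exists_matching_at [Finite V] {G : MixedGraph V} {z r : ℕ} (hz : z = 1 ∨ z = 2)
    (hreg : G.IsRegular z r) (x y : V) (hxy : G.edge.Adj x y) (E : V → V → Prop)
    (hE : IsMatchingRel {p | G.arc p y} {q | G.arc y q} E) :
    ∃ M, IsMatchingRel {p | G.arc p x} {q | G.arc x q} M ∧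
      ∀ p q, M p q → ¬ G.arc p q ∧ ¬ E p q := by
  -- If all of `Q` were blocked for `p`, then `x` and the members of `Q`, with `y` in place of the
  -- at most one blocked only by `E'`, would be `z + 1` distinct `R`-neighbours of `p`. The relation
  -- `R` is the arcs or their reversal.
  have key : ∀ (R : V → V → Prop) (E' : V → V → Prop) (p : V) (Q : Set V), Q.ncard = z →
      {q | R p q}.ncard = z → R p x → x ∉ Q → y ∉ Q → (∀ q, E' p q → R p y) →
      (∀ q q', E' p q → E' p q' → q = q') → ∃ q ∈ Q, ¬ (R p q ∨ E' p q) := by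
    intro R E' p Q hQ hR hpx hxQ hyQ hE' hinj
    by_contra hcon
    push Not at hcon
    have hmaps : ∀ q ∈ insert x Q, R p q ∨ E' p q := by
      rintro q (rfl | hq)
      · exact Or.inl hpx
      · exact hcon q hq
    classical
    have hle : (insert x Q).ncard ≤ {q | R p q}.ncard := by
      refine Set.ncard_le_ncard_of_injOn (fun q => if R p q then q else y) ?_ ?_ (Set.toFinite _)
      · intro q hq
        by_cases h : R p q
        · simp [h]
        · have := hE' q ((hmaps q hq).resolve_left h)
          simpa [h] using this
      · intro a ha b hb hab
        have hyI : ∀ c ∈ insert x Q, c ≠ y := by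
          rintro c (rfl | hc) rfl
          · exact hxy.ne rfl
          · exact hyQ hc
        simp only at hab
        split_ifs at hab with h₁ h₂ h₂
        · exact hab
        · exact absurd hab (hyI a ha)
        · exact absurd hab.symm (hyI b hb)
        · exact hinj a b ((hmaps a ha).resolve_left h₁) ((hmaps b hb).resolve_left h₂)
    rw [Set.ncard_insert_of_notMem hxQ, hR, hQ] at hle
    omega
  obtain ⟨hout, hin, -⟩ := hreg x
  obtain ⟨M, hM, hME⟩ := exists_isMatchingRel hz hin hout (fun p q => G.arc p q ∨ E p q)
    (fun p hp => key G.arc E p _ hout (hreg p).1 hp (fun h => G.arc_ne h rfl)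
      (fun h => G.arc_not_edge _ _ h hxy) (fun q hq => hE.left_mem p q hq)
      (fun q q' hq hq' => (hE.left p (hE.left_mem p q hq)).unique hq hq'))
    (fun q hq => key (fun a b => G.arc b a) (fun a b => E b a) q _ hin (hreg q).2.1 hq
      (fun h => G.arc_ne h rfl) (fun h => G.arc_not_edge _ _ h hxy.symm)
      (fun p hp => hE.right_mem p q hp)
      (fun p p' hp hp' => (hE.right q (hE.right_mem p q hp)).unique hp hp'))
  exact ⟨M, hM, fun p q h => not_or.1 (hME p q h)⟩

/-- The arcs at `x` can be matched avoiding the arcs of `G`. -/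
theorem exists_matching_at_vertex [Finite V] {G : MixedGraph V} {z r : ℕ} (hz : z = 1 ∨ z = 2)
    (hreg : G.IsRegular z r) (x : V) :
    ∃ M, IsMatchingRel {p | G.arc p x} {q | G.arc x q} M ∧ ∀ p q, M p q → ¬ G.arc p q := by
  have key : ∀ (R : V → V → Prop) (p : V) (Q : Set V), Q.ncard = z →
      {q | R p q}.ncard = z → R p x → x ∉ Q → ∃ q ∈ Q, ¬ R p q := by
    intro R p Q hQ hR hpx hxQ
    by_contra! hcon
    have hle : (insert x Q).ncard ≤ {q | R p q}.ncard :=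
      Set.ncard_le_ncard (Set.insert_subset hpx hcon) (Set.toFinite _)
    rw [Set.ncard_insert_of_notMem hxQ, hR, hQ] at hle
    omega
  obtain ⟨hout, hin, -⟩ := hreg x
  exact exists_isMatchingRel hz hin hout G.arc
    (fun p hp => key G.arc p _ hout (hreg p).1 hp (fun h => G.arc_ne h rfl))
    (fun q hq => key (fun a b => G.arc b a) q _ hin (hreg q).2.1 hq (fun h => G.arc_ne h rfl))

/-- If the degree in edges is even, then a single vertex can be split off. -/
theorem exists_splitting_of_even [Finite V] {G : MixedGraph V} {z r : ℕ} (hz : z = 1 ∨ z = 2)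
    (hr : Even r) (hreg : G.IsRegular z r) (x : V) :
    ∃ A B, G.Splitting {x} A B := by
  obtain ⟨M, hM, hMnew⟩ := exists_matching_at_vertex hz hreg x
  obtain ⟨B, hBs, hBm, hBi, hBu⟩ := exists_pairing (Set.toFinite {u | G.edge.Adj x u})
    (by rw [(hreg x).2.2]; exact hr)
  refine ⟨fun s p q => s = x ∧ M p q, fun s u v => s = x ∧ B u v, ?_, ?_, ?_, ?_, ?_, ?_, ?_, ?_,
    ?_, ?_, ?_⟩
  · rintro s rfl t rfl h
    exact absurd rfl h
  · rintro s rfl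
    simpa using hM
  · exact fun s p q h => h.1
  · exact fun s p q h => hMnew p q h.2
  · exact fun s t p q h h' => h.1.trans h'.1.symm
  · exact fun s u v h => h.1
  · exact fun s u v h => ⟨h.1, hBs u v h.2⟩
  · exact fun s u h => hBi u h.2
  · rintro s u v ⟨rfl, h⟩
    exact hBm u v h
  · rintro s u v ⟨rfl, h⟩ rfl
    exact G.edge.loopless.irrefl _ (hBm _ v h)
  · rintro s rfl u hu -
    simpa using hBu u hu

/-- If the degree in edges is odd, then the two ends of an edge can be split off. -/
theorem exists_splitting_of_odd [Finite V] {G : MixedGraph V} {z r : ℕ} (hz : z = 1 ∨ z = 2)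
    (hr : Odd r) (hreg : G.IsRegular z r) {x y : V} (hxy : G.edge.Adj x y) :
    ∃ A B, G.Splitting {x, y} A B := by
  have hne := hxy.ne
  obtain ⟨My, hMy, hMynew⟩ := exists_matching_at_vertex hz hreg y
  obtain ⟨Mx, hMx, hMxnew⟩ := exists_matching_at hz hreg x y hxy My hMy
  have hpair : ∀ a b, G.edge.Adj a b → ∃ B : V → V → Prop, (∀ u v, B u v → B v u) ∧
      (∀ u v, B u v → G.edge.Adj a u ∧ u ≠ b) ∧ (∀ u, ¬ B u u) ∧
      ∀ u, G.edge.Adj a u → u ≠ b → ∃! v, B u v := by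
    intro a b hab
    obtain ⟨B, h₁, h₂, h₃, h₄⟩ := exists_pairing (U := {u | G.edge.Adj a u} \ {b})
      -- The other deleted end is left out, so `r - 1` neighbours remain, an even number.
      (Set.toFinite _) (by
        rw [Set.ncard_sdiff_singleton_of_mem (show b ∈ {u | G.edge.Adj a u} from hab), (hreg a).2.2]
        exact Nat.Odd.sub_odd hr odd_one)
    exact ⟨B, h₁, h₂, h₃, fun u hu hub => h₄ u ⟨hu, hub⟩⟩
  obtain ⟨Bx, hBxs, hBxm, hBxi, hBxu⟩ := hpair x y hxy
  obtain ⟨By, hBys, hBym, hByi, hByu⟩ := hpair y x hxy.symm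
  refine ⟨fun s p q => s = x ∧ Mx p q ∨ s = y ∧ My p q,
    fun s u v => s = x ∧ Bx u v ∨ s = y ∧ By u v, ?_, ?_, ?_, ?_, ?_, ?_, ?_, ?_, ?_, ?_, ?_⟩
  · rintro s (rfl | rfl) t (rfl | rfl) h
    · exact absurd rfl h
    · exact hxy
    · exact hxy.symm
    · exact absurd rfl h
  · rintro s (rfl | rfl)
    · simpa [hne] using hMx
    · simpa [hne.symm] using hMy
  · rintro s p q (h | h)
    · exact Or.inl h.1
    · exact Or.inr h.1
  · rintro s p q (h | h)
    · exact (hMxnew p q h.2).1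
    · exact hMynew p q h.2
  · rintro s t p q (⟨rfl, h⟩ | ⟨rfl, h⟩) (⟨rfl, h'⟩ | ⟨rfl, h'⟩)
    · rfl
    · exact absurd h' (hMxnew p q h).2
    · exact absurd h (hMxnew p q h').2
    · rfl
  · rintro s p q (h | h)
    · exact Or.inl h.1
    · exact Or.inr h.1
  · rintro s p q (h | h)
    · exact Or.inl ⟨h.1, hBxs _ _ h.2⟩
    · exact Or.inr ⟨h.1, hBys _ _ h.2⟩
  · rintro s u (h | h)
    · exact hBxi u h.2
    · exact hByi u h.2
  · rintro s u v (⟨rfl, h⟩ | ⟨rfl, h⟩)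
    · exact (hBxm u v h).1
    · exact (hBym u v h).1
  · rintro s u v (⟨rfl, h⟩ | ⟨rfl, h⟩) (rfl | rfl)
    · exact (hBxm _ v h).1.ne rfl
    · exact (hBxm _ v h).2 rfl
    · exact (hBym _ v h).2 rfl
    · exact (hBym _ v h).1.ne rfl
  · rintro s (rfl | rfl) u hu huS
    · simpa [hne] using hBxu u hu (fun h => huS (Or.inr h))
    · simpa [hne.symm] using hByu u hu (fun h => huS (Or.inl h))

/-! ### Minimal orders and strict monotonicity -/

/-- `N` is the order of a nonempty mixed graph, regular of degrees `z` and `r`, without cycles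
shorter than `g`. -/
def IsOrderGE (z r g N : ℕ) : Prop :=
  ∃ (V : Type) (_ : Finite V) (_ : Nonempty V) (G : MixedGraph V),
    G.IsRegular z r ∧ G.GirthGE g ∧ Nat.card V = N

theorem Splitting.exists_isOrderGE_lt {V : Type} [Finite V] {G : MixedGraph V} {S : Set V}
    {A B : V → V → V → Prop} (h : G.Splitting S A B) {z r g : ℕ} (hz : 1 ≤ z) (hg : 3 ≤ g)
    (hreg : G.IsRegular z r) (hG : G.GirthGE (g + 1)) (hS : S.Nonempty) :
    ∃ N, IsOrderGE z r g N ∧ N < Nat.card V := by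
  obtain ⟨s, hs⟩ := hS
  -- An out-neighbour of `s` lies outside the clique, so the remaining graph is nonempty.
  have hpos : {w | G.arc s w}.Nonempty := by
    apply Set.nonempty_of_ncard_ne_zero
    rw [(hreg s).1]
    omega
  obtain ⟨w, hw⟩ := hpos
  refine ⟨_, ⟨(Sᶜ : Set V), inferInstance, ⟨⟨w, h.notMem_of_arc_from hs hw⟩⟩,
    h.graph hG (by omega), h.graph_isRegular hG _ hreg, h.graph_girthGE hG _, rfl⟩, ?_⟩
  rw [Nat.card_coe_set_eq]
  exact Set.ncard_lt_card (fun hu => (hu ▸ Set.mem_univ s : s ∈ Sᶜ) hs)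

theorem IsOrderGE.exists_lt {z r g N : ℕ} (hz : z = 1 ∨ z = 2) (hr : 1 ≤ r) (hg : 3 ≤ g)
    (h : IsOrderGE z r (g + 1) N) : ∃ N' < N, IsOrderGE z r g N' := by
  obtain ⟨V, _, ⟨x⟩, G, hreg, hG, rfl⟩ := h
  have hz1 : 1 ≤ z := by omega
  rcases Nat.even_or_odd r with he | ho
  · obtain ⟨A, B, hs⟩ := exists_splitting_of_even hz he hreg x
    obtain ⟨N, hN, hlt⟩ := hs.exists_isOrderGE_lt hz1 hg hreg hG ⟨x, by simp⟩
    exact ⟨N, hlt, hN⟩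
  · have hpos : {w | G.edge.Adj x w}.Nonempty := by
      apply Set.nonempty_of_ncard_ne_zero
      rw [(hreg x).2.2]
      omega
    obtain ⟨y, hxy⟩ := hpos
    obtain ⟨A, B, hs⟩ := exists_splitting_of_odd hz ho hreg hxy
    obtain ⟨N, hN, hlt⟩ := hs.exists_isOrderGE_lt hz1 hg hreg hG ⟨x, by simp⟩
    exact ⟨N, hlt, hN⟩

theorem IsOrderGE.mono {z r g g' N : ℕ} (h : IsOrderGE z r g N) (hg : g' ≤ g) :
    IsOrderGE z r g' N := by
  obtain ⟨V, hV, hne, G, hreg, hG, hN⟩ := h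
  exact ⟨V, hV, hne, G, hreg, hG.mono hg, hN⟩

theorem exists_isOrderGE (z r g : ℕ) : ∃ N, IsOrderGE z r g N := by
  have := finite_reducedWord r (g + 1)
  -- This modulus exceeds both `2 * z` and `z * L` for `L = g + 1`.
  have : NeZero (z * (g + 2) + z + 1) := ⟨by omega⟩
  have hm : 2 * z < z * (g + 2) + z + 1 := by nlinarith [Nat.zero_le (z * g)]
  refine ⟨_, _, inferInstance, ⟨(1, 0)⟩, cayley z r (g + 1) (z * (g + 2) + z + 1)
    (Nat.succ_pos g) hm, cayley_isRegular _ _ _ _ _ _, ?_, rfl⟩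
  intro n c hc
  have := cayley_lt_of_isCycle (Nat.succ_pos g) hm (by nlinarith) hc
  omega

theorem isOrderGE_of_mem_orders {z r g N : ℕ} (h : N ∈ orders z r g) : IsOrderGE z r g N := by
  obtain ⟨V, hV, G, hreg, ⟨⟨c, hc⟩, hle⟩, hN⟩ := h
  exact ⟨V, hV, ⟨c 0⟩, G, hreg, fun n c hc => hle ⟨c, hc⟩, hN⟩

/-- A smallest regular mixed graph without cycles shorter than `g` has girth `g`. -/
theorem isLeast_orders {z r g N : ℕ} (hz : z = 1 ∨ z = 2) (hr : 1 ≤ r) (hg : 3 ≤ g)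
    (hN : IsLeast {N | IsOrderGE z r g N} N) : IsLeast (orders z r g) N := by
  refine ⟨?_, fun N' hN' => hN.2 (isOrderGE_of_mem_orders hN')⟩
  obtain ⟨V, hV, hne, G, hreg, hG, hcard⟩ := hN.1
  refine ⟨V, hV, G, hreg, ⟨?_, fun n ⟨c, hc⟩ => hG n c hc⟩, hcard⟩
  by_contra hno
  have hG' : G.GirthGE (g + 1) := by
    intro n c hc
    refine Nat.succ_le_of_lt (lt_of_le_of_ne (hG n c hc) ?_)
    rintro rfl
    exact hno ⟨c, hc⟩
  obtain ⟨N', hlt, hN'⟩ := IsOrderGE.exists_lt hz hr hg ⟨V, hV, hne, G, hreg, hG', hcard⟩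
  exact absurd (hN.2 hN') (by omega)

theorem exists_isLeast_isOrderGE (z r g : ℕ) : ∃ N, IsLeast {N | IsOrderGE z r g N} N :=
  ⟨_, Nat.sInf_mem (exists_isOrderGE z r g), fun _ h => Nat.sInf_le h⟩

end MixedGraph

theorem mainTheorem1 (z r g₁ g₂ : ℕ) (hz : z = 1 ∨ z = 2) (hr : 1 ≤ r)
    (hg₁ : 3 ≤ g₁) (hg : g₁ < g₂) :
    (MixedGraph.orders z r g₁).Nonempty ∧ (MixedGraph.orders z r g₂).Nonempty ∧
      MixedGraph.cageOrder z r g₁ < MixedGraph.cageOrder z r g₂ := by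
  obtain ⟨N₁, hN₁⟩ := MixedGraph.exists_isLeast_isOrderGE z r g₁
  obtain ⟨N₂, hN₂⟩ := MixedGraph.exists_isLeast_isOrderGE z r g₂
  have h₁ := MixedGraph.isLeast_orders hz hr hg₁ hN₁
  have h₂ := MixedGraph.isLeast_orders hz hr (by omega) hN₂
  refine ⟨⟨N₁, h₁.1⟩, ⟨N₂, h₂.1⟩, ?_⟩
  rw [MixedGraph.cageOrder, MixedGraph.cageOrder, h₁.csInf_eq, h₂.csInf_eq]
  -- As `g₁ + 1 ≤ g₂`, one reduction suffices, whatever the gap.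
  obtain ⟨N', hlt, hN'⟩ := MixedGraph.IsOrderGE.exists_lt hz hr hg₁ (hN₂.1.mono hg)
  exact lt_of_le_of_lt (hN₁.2 hN') hlt
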